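/- **Notation.** For $l\in\mathbb N=\{0,1,2,\dots\}$ and $m\in\{-l,\dots,l\}$ let $Y_{l,m}(\theta,\phi)=\sqrt{\frac{(l-m)!\,(2l+1)}{4\pi\,(l+m)!}}\;e^{im\phi}P_l^m(\cos\theta)$ be the complex spherical harmonic, where $P_l^m$ is the Ferrers function with the Condon–Shortley phase $(-1)^m$, and let $\check Y_{l,m}=\sqrt2\,\Im Y_{l,m}$ for $m<0$, $\check Y_{l,0}=Y_{l,0}$, $\check Y_{l,m}=\sqrt2\,\Re Y_{l,m}$ for $m>0$ be the real spherical harmonics. A function of the spherical angles $(\theta,\phi)$ is regarded as a function of the nonzero vectors $x\in\mathbb R^3$ through the angles of $x$. For a rotation matrix $R$ let $(P(R)f)(x)=f(R^{-1}x)$, and let $D_{l,m,m'}(R)=\int_0^\pi\int_0^{2\pi}\overline{Y_{l,m'}}\,(P(R)Y_{l,m})\,\sin\theta\,d\phi\,d\theta$ be the Wigner $D$ coefficients (matrix elements of $P(R)$ between the $Y_{l,m}$). Let $G$ be a finite group of order $N_g$ with a homomorphism $g\mapsto R_g\in SO(3)$. Let $\Gamma^p$ be a $d_p$-dimensional unitary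 irreducible matrix representation of $G$ over $\mathbb C$ that is potentially real, with the real orthogonal irrep matrices $\Gamma_r^p(g)\in\mathbb R^{d_p\times d_p}$; that is, $\Gamma_r^p(g)=S^H\Gamma^p(g)S$ for all $g\in G$ with some unitary matrix $S$. For $j,k\in\{1,\dots,d_p\}$ define the projection operator $$\mathcal P^p_{j,k}=\frac{d_p}{N_g}\sum_{g\in G}\big(\Gamma_r^p(g)\big)_{j,k}^{*}\,P(R_g).$$ **Lemma.** For all $j,k\in\{1,\dots,d_p\}$, $l\in\mathbb N$ and $m\in\{-l,\dots,l\}$, $$\mathcal P^p_{j,k}\check Y_{l,m}(\theta,\phi)=\sum_{m'=-l}^{l}\check{\mathcal D}^p_{j,k;l,m;m'}\,\check Y_{l,m'}(\theta,\phi)=\sum_{m'=-l}^{l}\hat{\mathcal D}^p_{j,k;l,m;m'}\,Y_{l,m'}(\theta,\phi),$$ where $$\check{\mathcal D}^p_{j,k;l,m;m'}=\frac{d_p}{N_g}\sum_{g\in G}(\Gamma_r^p(g))_{j,k}\,\check D_{l,m,m'}(R_g),\qquad \hat{\mathcal D}^p_{j,k;l,m;m'}=\frac{d_p}{N_g}\sum_{g\in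 G}(\Gamma_r^p(g))_{j,k}\,\hat D_{l,m,m'}(R_g),$$ $$\hat D_{l,m,m'}=\begin{cases}-\frac{i}{\sqrt2}\left(D_{l,m,m'}-(-1)^mD_{l,-m,m'}\right),&m<0\\ D_{l,0,m'},&m=0\\ \frac1{\sqrt2}\left(D_{l,m,m'}+(-1)^mD_{l,-m,m'}\right),&m>0\end{cases}$$ and $$\check D_{l,m,m'}=\begin{cases} \frac12\left[D_{l,m,m'}-(-1)^mD_{l,-m,m'}-(-1)^{m'}D_{l,m,-m'}+(-1)^{m+m'}D_{l,-m,-m'}\right],&m<0,\ m'<0\\ -\frac{i}{\sqrt2}\left[D_{l,m,0}-(-1)^mD_{l,-m,0}\right],&m<0,\ m'=0\\ -\frac i2\left[D_{l,m,m'}-(-1)^mD_{l,-m,m'}+(-1)^{m'}D_{l,m,-m'}-(-1)^{m+m'}D_{l,-m,-m'}\right],&m<0,\ m'>0\\ \frac{i}{\sqrt2}\left[D_{l,0,m'}-(-1)^{m'}D_{l,0,-m'}\right],&m=0,\ m'<0\\ D_{l,0,0},&m=0,\ m'=0\\ \frac1{\sqrt2}\left[D_{l,0,m'}+(-1)^{m'}D_{l,0,-m'}\right],&m=0,\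 m'>0\\ \frac i2\left[D_{l,m,m'}+(-1)^mD_{l,-m,m'}-(-1)^{m'}D_{l,m,-m'}-(-1)^{m+m'}D_{l,-m,-m'}\right],&m>0,\ m'<0\\ \frac1{\sqrt2}\left[D_{l,m,0}+(-1)^mD_{l,-m,0}\right],&m>0,\ m'=0\\ \frac12\left[D_{l,m,m'}+(-1)^mD_{l,-m,m'}+(-1)^{m'}D_{l,m,-m'}+(-1)^{m+m'}D_{l,-m,-m'}\right],&m>0,\ m'>0. \end{cases}$$ -/

import Mathlib

noncomputable section

/-- Euclidean three-space. -/
abbrev E3 : Type := EuclideanSpace ℝ (Fin 3)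

/-- The group of rotation matrices `R`, i.e. `Rᵀ = R⁻¹` and `det R = 1`. -/
abbrev SO3 : Type := Matrix.specialOrthogonalGroup (Fin 3) ℝ

/-! Spherical harmonics -/

/-- The Legendre polynomial `P_l`, by Rodrigues' formula. -/
def legendrePoly (l : ℕ) : Polynomial ℝ :=
  Polynomial.C (1 / (2 ^ l * (l.factorial : ℝ))) *
    Polynomial.derivative^[l] ((Polynomial.X ^ 2 - 1) ^ l)

/-- The Ferrers function `P_l^m(x)` (`-1 ≤ x ≤ 1`) of degree `l` and order `m ∈ {-l, …, l}`, with the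
Condon–Shortley phase: `P_l^m(x) = (-1)^m (1 - x²)^{m/2} (d/dx)^m P_l(x)` for `m ≥ 0`, and
`P_l^{-m} = (-1)^m (l - m)! / (l + m)! P_l^m`. -/
def ferrers (l : ℕ) : ℤ → ℝ → ℝ
  | Int.ofNat m, x =>
      (-1) ^ m * Real.sqrt (1 - x ^ 2) ^ m *
        (Polynomial.derivative^[m] (legendrePoly l)).eval x
  | Int.negSucc n, x =>
      (-1) ^ (n + 1) * (((l - (n + 1)).factorial : ℝ) / ((l + (n + 1)).factorial : ℝ)) *
        ((-1) ^ (n + 1) * Real.sqrt (1 - x ^ 2) ^ (n + 1) *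
          (Polynomial.derivative^[n + 1] (legendrePoly l)).eval x)

/-- The complex spherical harmonic `Y_{l,m}(θ, φ)`, for `-l ≤ m ≤ l`:
`√((l - m)! (2l + 1) / (4π (l + m)!)) e^{imφ} P_l^m(cos θ)`. -/
def sphY (l : ℕ) (m : ℤ) (θ φ : ℝ) : ℂ :=
  ((Real.sqrt ((((l : ℤ) - m).toNat.factorial : ℝ) * (2 * l + 1) /
      (4 * Real.pi * (((l : ℤ) + m).toNat.factorial : ℝ))) : ℝ) : ℂ) *
    Complex.exp (Complex.I * m * φ) * ((ferrers l m (Real.cos θ) : ℝ) : ℂ)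

/-- The real spherical harmonic `Y̌_{l,m}(θ, φ)`. -/
def realSphY (l : ℕ) (m : ℤ) (θ φ : ℝ) : ℝ :=
  if m < 0 then Real.sqrt 2 * (sphY l m θ φ).im
  else if m = 0 then (sphY l 0 θ φ).re
  else Real.sqrt 2 * (sphY l m θ φ).re

/-! Spherical coordinates and rotations of functions -/

/-- The polar angle `θ ∈ [0, π]` of a nonzero vector. -/
def polarAngle (x : E3) : ℝ := Real.arccos (x 2 / ‖x‖)

/-- The azimuthal angle `φ` of a vector, modulo `2π`; every function of the angles to which it is
applied has period `2π` in `φ`. On the `z`-axis, where it is not determined, it is `0`. -/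
def azimuth (x : E3) : ℝ := Complex.arg ⟨x 0, x 1⟩

/-- The unit vector with spherical coordinates `(θ, φ)`. -/
def unitVec (θ φ : ℝ) : E3 :=
  !₂[Real.sin θ * Real.cos φ, Real.sin θ * Real.sin φ, Real.cos θ]

/-- A function of the angles `(θ, φ)`, regarded as a function on the nonzero vectors of space. -/
def onVec (f : ℝ → ℝ → ℂ) (x : E3) : ℂ := f (polarAngle x) (azimuth x)

/-- The rotation operator `(P(R) f)(x) = f(R⁻¹ x)`. -/
def rotOp (R : SO3) (f : E3 → ℂ) (x : E3) : ℂ :=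
  f (Matrix.toEuclideanLin ((R⁻¹ : SO3) : Matrix (Fin 3) (Fin 3) ℝ) x)

/-- The Wigner coefficient `D_{l,m,m'}(R) = ⟨Y_{l,m'}, P(R) Y_{l,m}⟩`: the matrix element of the
rotation operator between spherical harmonics of degree `l`, for the inner product
`⟨u, v⟩ = ∫_0^π ∫_0^{2π} conj (u) v sin θ dφ dθ` on the sphere. -/
def wignerD (l : ℕ) (m m' : ℤ) (R : SO3) : ℂ :=
  ∫ θ in (0 : ℝ)..Real.pi, ∫ φ in (0 : ℝ)..(2 * Real.pi),
    (starRingEnd ℂ) (sphY l m' θ φ) * rotOp R (onVec (sphY l m)) (unitVec θ φ) *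
      ((Real.sin θ : ℝ) : ℂ)

/-! The transformed Wigner coefficients -/

/-- `D̂_{l,m,m'}(R)`. -/
def hatD (l : ℕ) (m m' : ℤ) (R : SO3) : ℂ :=
  if m < 0 then
    -(Complex.I / (Real.sqrt 2 : ℂ)) *
      (wignerD l m m' R - (-1) ^ m * wignerD l (-m) m' R)
  else if m = 0 then wignerD l 0 m' R
  else
    (1 / (Real.sqrt 2 : ℂ)) *
      (wignerD l m m' R + (-1) ^ m * wignerD l (-m) m' R)

/-- `Ď_{l,m,m'}(R)`. -/
def checkD (l : ℕ) (m m' : ℤ) (R : SO3) : ℂ :=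
  if m < 0 then
    if m' < 0 then
      (1 / 2) * (wignerD l m m' R - (-1) ^ m * wignerD l (-m) m' R
        - (-1) ^ m' * wignerD l m (-m') R + (-1) ^ (m + m') * wignerD l (-m) (-m') R)
    else if m' = 0 then
      -(Complex.I / (Real.sqrt 2 : ℂ)) *
        (wignerD l m 0 R - (-1) ^ m * wignerD l (-m) 0 R)
    else
      -(Complex.I / 2) * (wignerD l m m' R - (-1) ^ m * wignerD l (-m) m' R
        + (-1) ^ m' * wignerD l m (-m') R - (-1) ^ (m + m') * wignerD l (-m) (-m') R)
  else if m = 0 then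
    if m' < 0 then
      (Complex.I / (Real.sqrt 2 : ℂ)) *
        (wignerD l 0 m' R - (-1) ^ m' * wignerD l 0 (-m') R)
    else if m' = 0 then wignerD l 0 0 R
    else
      (1 / (Real.sqrt 2 : ℂ)) *
        (wignerD l 0 m' R + (-1) ^ m' * wignerD l 0 (-m') R)
  else
    if m' < 0 then
      (Complex.I / 2) * (wignerD l m m' R + (-1) ^ m * wignerD l (-m) m' R
        - (-1) ^ m' * wignerD l m (-m') R - (-1) ^ (m + m') * wignerD l (-m) (-m') R)
    else if m' = 0 then
      (1 / (Real.sqrt 2 : ℂ)) *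
        (wignerD l m 0 R + (-1) ^ m * wignerD l (-m) 0 R)
    else
      (1 / 2) * (wignerD l m m' R + (-1) ^ m * wignerD l (-m) m' R
        + (-1) ^ m' * wignerD l m (-m') R + (-1) ^ (m + m') * wignerD l (-m) (-m') R)

/-! Matrix representations, real forms and projection operators -/

/-- The representation on `ℂ^d` given by a family of unitary matrices. -/
def matrixRep {G : Type*} [Group G] {d : ℕ} (Γ : G →* Matrix.unitaryGroup (Fin d) ℂ) :
    Representation ℂ G (Fin d → ℂ) :=
  ((Matrix.toLinAlgEquiv' : Matrix (Fin d) (Fin d) ℂ ≃ₐ[ℂ] _) :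
      Matrix (Fin d) (Fin d) ℂ →* ((Fin d → ℂ) →ₗ[ℂ] Fin d → ℂ)).comp
    ((Matrix.unitaryGroup (Fin d) ℂ).subtype.comp Γ)

/-- The real orthogonal matrices `Γr g`, regarded as complex matrices. -/
def complexify {G : Type*} [Group G] {d : ℕ} (Γr : G →* Matrix.orthogonalGroup (Fin d) ℝ) (g : G) :
    Matrix (Fin d) (Fin d) ℂ :=
  ((Γr g : Matrix.orthogonalGroup (Fin d) ℝ) : Matrix (Fin d) (Fin d) ℝ).map Complex.ofReal

/-- The unitary matrix representation `Γ` is potentially real, with the real orthogonal matrices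
`Γr`: there is a unitary matrix `S` with `Sᴴ Γ(g) S = Γr(g)` for all `g`. -/
def IsRealForm {G : Type*} [Group G] {d : ℕ} (Γ : G →* Matrix.unitaryGroup (Fin d) ℂ)
    (Γr : G →* Matrix.orthogonalGroup (Fin d) ℝ) : Prop :=
  ∃ S ∈ Matrix.unitaryGroup (Fin d) ℂ, ∀ g : G,
    S.conjTranspose * (Γ g : Matrix (Fin d) (Fin d) ℂ) * S = complexify Γr g

/-- The projection operator `𝒫_{j,k} = (d / |G|) ∑_g conj (Γ(g)_{j,k}) P(g)`, where `P(g)` is the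
rotation operator of the rotation matrix `ρ g` of `g`. -/
def projOp {G : Type*} [Group G] [Fintype G] {d : ℕ} (ρ : G →* SO3)
    (Γ : G → Matrix (Fin d) (Fin d) ℂ) (j k : Fin d) (f : E3 → ℂ) (x : E3) : ℂ :=
  ((d : ℂ) / (Fintype.card G : ℂ)) *
    ∑ g : G, (starRingEnd ℂ) (Γ g j k) * rotOp (ρ g) f x

/-- The coefficient `𝒟̌_{j,k;l,m;m'}`. -/
def checkCoeff {G : Type*} [Group G] [Fintype G] {d : ℕ} (ρ : G →* SO3)
    (Γr : G →* Matrix.orthogonalGroup (Fin d) ℝ) (j k : Fin d) (l : ℕ) (m m' : ℤ) : ℂ :=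
  ((d : ℂ) / (Fintype.card G : ℂ)) *
    ∑ g : G, (((Γr g : Matrix (Fin d) (Fin d) ℝ) j k : ℝ) : ℂ) * checkD l m m' (ρ g)

/-- The coefficient `𝒟̂_{j,k;l,m;m'}`. -/
def hatCoeff {G : Type*} [Group G] [Fintype G] {d : ℕ} (ρ : G →* SO3)
    (Γr : G →* Matrix.orthogonalGroup (Fin d) ℝ) (j k : Fin d) (l : ℕ) (m m' : ℤ) : ℂ :=
  ((d : ℂ) / (Fintype.card G : ℂ)) *
    ∑ g : G, (((Γr g : Matrix (Fin d) (Fin d) ℝ) j k : ℝ) : ℂ) * hatD l m m' (ρ g)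

end

/-!
Let `u = x₀ + i x₁` and `z = x₂`. The linear form `(-conj u + 2 z s + u s²)` of `x` has the isotropic
coefficient vector `(s² - 1, i (s² + 1), 2 s)`, and the coefficient of `s^(l+m)` in its `l`-th power
is, on the unit sphere, a multiple of `Y_{l,m}` (`sphY_eq_coeff`). This follows from Rodrigues'
formula, because by Taylor's formula `(x² - 1 + 2 x t + t²) ^ l = ((x + t)² - 1) ^ l` generates the
derivatives of `(x² - 1) ^ l`.

A rotation maps isotropic vectors to isotropic vectors, and every `l`-th power of an isotropic linear
form is a combination of the coefficients of that generating polynomial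
(`isotropic_pow_eq_sum`). Since the coefficients are combinations of values at `2 l + 1` points
(Lagrange interpolation), the span of the `Y_{l,m}` with `l` fixed is invariant under rotations
(`exists_rotOp_sphY`). The `Y_{l,m}` are orthonormal (`integral_conj_sphY_mul`,
`integral_polarPart_sq`), by integration by parts for the associated Legendre functions, so the
coefficients of the expansion of `P(R) Y_{l,m}` are the Wigner coefficients (`rotOp_sphY`).

The rest is linear algebra. By `conj Y_{l,m} = (-1)^m Y_{l,-m}`, the real spherical harmonics arise
from the complex ones by a unitary change of basis (`realComb`) that mixes the orders `m` and `-m`.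
Applied to the first index of `D` it gives `D̂`, and its complex conjugate applied to the second index
gives `Ď`. Averaging over the group with the real weights `Γr(g)_{j,k}` is linear.
-/

noncomputable section

open Polynomial

/-! ### Powers of a quadratic polynomial -/

/-- The generating polynomial `(a + b X + c X²) ^ l`. -/
def quadPow {R : Type*} [CommRing R] (l : ℕ) (a b c : R) : R[X] :=
  (C a + C b * X + C c * X ^ 2) ^ l

section QuadPow

variable {R : Type*} [CommRing R]

lemma natDegree_quad_le (a b c : R) : (C a + C b * X + C c * X ^ 2).natDegree ≤ 2 := by
  compute_degree

lemma natDegree_quadPow_le (l : ℕ) (a b c : R) : (quadPow l a b c).natDegree ≤ 2 * l := by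
  rw [quadPow, mul_comm 2 l]
  exact natDegree_pow_le_of_le l (natDegree_quad_le a b c)

lemma quadPow_coeff_two_mul (l : ℕ) (a b c : R) : (quadPow l a b c).coeff (2 * l) = c ^ l := by
  rw [quadPow, mul_comm 2 l, coeff_pow_of_natDegree_le (natDegree_quad_le a b c)]
  simp

lemma quadPow_eval (l : ℕ) (a b c s : R) :
    (quadPow l a b c).eval s = (a + b * s + c * s ^ 2) ^ l := by
  simp [quadPow]

lemma quadPow_map {S : Type*} [CommRing S] (f : R →+* S) (l : ℕ) (a b c : R) :
    (quadPow l a b c).map f = quadPow l (f a) (f b) (f c) := by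
  simp [quadPow, Polynomial.map_pow]

lemma reflect_quadPow (l : ℕ) (a b c : R) :
    reflect (2 * l) (quadPow l a b c) = quadPow l c b a := by
  induction l with
  | zero => simp [quadPow]
  | succ l ih =>
    have h : reflect 2 (C a + C b * X + C c * X ^ 2) = C c + C b * X + C a * X ^ 2 := by
      have h1 : reflect 2 (C b * X : R[X]) = C b * X := by
        have := reflect_C_mul_X_pow 2 1 (c := b)
        simpa [revAt_le] using this
      have h2 : reflect 2 (C c * X ^ 2 : R[X]) = C c := by
        simp
      rw [reflect_add, reflect_add, reflect_C, h1, h2]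
      ring
    have e : quadPow (l + 1) a b c = quadPow l a b c * (C a + C b * X + C c * X ^ 2) := by
      simp [quadPow, pow_succ]
    rw [e, mul_add, mul_one, reflect_mul _ _ (natDegree_quadPow_le l a b c)
      (natDegree_quad_le a b c), ih, h]
    simp [quadPow, pow_succ]

lemma quadPow_coeff_sub_eq (l m : ℕ) (hm : m ≤ l) (a b c : R) :
    (quadPow l a b c).coeff (l - m) = (quadPow l c b a).coeff (l + m) := by
  rw [← reflect_quadPow l a b c, coeff_reflect, revAt_le (by omega)]
  congr 1
  omega

lemma quadPow_zero_left (l : ℕ) (b c : R) : quadPow l 0 b c = X ^ l * (C b + C c * X) ^ l := by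
  rw [quadPow, ← mul_pow]
  congr 1
  simp
  ring

lemma quadPow_smul (l : ℕ) (r a b c : R) :
    quadPow l (r * a) (r * b) (r * c) = C (r ^ l) * quadPow l a b c := by
  rw [quadPow, quadPow, C_pow, ← mul_pow]
  congr 1
  simp
  ring

end QuadPow

section QuadPowField

variable {K : Type*} [Field K]

/-- The upper half of the coefficients of `(a + b X + c X²) ^ l` depends on `a` and `c` only through
`a c`, up to an explicit power of `c`: substitute `c X` for `X`. -/
lemma quadPow_coeff_add (l m : ℕ) (a b c : K) :
    (quadPow l a b c).coeff (l + m) = c ^ m * (quadPow l (a * c) b 1).coeff (l + m) := by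
  by_cases hc : c = 0
  -- For `c = 0` the substitution is not available, and both sides are computed directly.
  · subst hc
    rw [mul_zero, quadPow_zero_left, ← reflect_quadPow, coeff_reflect]
    rcases Nat.eq_zero_or_pos m with rfl | h0
    · rw [quadPow_zero_left, add_zero, coeff_X_pow_mul', revAt_le (by omega), if_pos (by omega)]
      have e : 2 * l - l - l = 0 := by omega
      rw [e, coeff_X_pow_mul', if_pos le_rfl, Nat.sub_self]
      simp [coeff_zero_eq_eval_zero]
    · rw [zero_pow h0.ne', zero_mul, quadPow_zero_left, coeff_X_pow_mul']
      by_cases h : m ≤ l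
      · rw [revAt_le (by omega), if_neg (by omega)]
      · rw [revAt_eq_self_of_lt (by omega), if_pos (by omega)]
        apply coeff_eq_zero_of_natDegree_lt
        have h1 : (C b + C a * X).natDegree ≤ 1 := by compute_degree
        have := natDegree_pow_le_of_le l h1
        omega
  · have h : (quadPow l (a * c) b 1).comp (C c * X) = C (c ^ l) * quadPow l a b c := by
      rw [← quadPow_smul]
      rw [quadPow, quadPow, pow_comp]
      refine congrArg (· ^ l) ?_
      simp only [add_comp, mul_comp, pow_comp, C_comp, X_comp, map_mul, map_one, one_comp]
      ring
    have h2 := congrArg (fun p => p.coeff (l + m)) h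
    simp only [comp_C_mul_X_coeff, coeff_C_mul] at h2
    have h3 : c ^ l ≠ 0 := pow_ne_zero _ hc
    apply mul_left_cancel₀ h3
    rw [← h2, pow_add]
    ring

lemma quadPow_coeff_sub (l m : ℕ) (hm : m ≤ l) (a b c : K) :
    (quadPow l a b c).coeff (l - m) = a ^ m * (quadPow l (a * c) b 1).coeff (l + m) := by
  rw [quadPow_coeff_sub_eq l m hm, quadPow_coeff_add, mul_comm c a]

end QuadPowField

/-! ### The derivatives in Rodrigues' formula -/

/-- Taylor's formula: `(x² - 1 + 2 x t + t²) ^ l = ((x + t)² - 1) ^ l` generates the derivatives of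
`(x² - 1) ^ l`. -/
lemma iterate_derivative_eval (l k : ℕ) (x : ℝ) :
    (derivative^[k] ((X ^ 2 - 1 : ℝ[X]) ^ l)).eval x =
      k.factorial * (quadPow l (x ^ 2 - 1) (2 * x) 1).coeff k := by
  have h : quadPow l (x ^ 2 - 1) (2 * x) 1 = taylor x ((X ^ 2 - 1 : ℝ[X]) ^ l) := by
    rw [taylor_apply, quadPow]
    simp only [pow_comp, sub_comp, X_comp, one_comp, map_sub, map_mul, map_one, map_pow]
    congr 1
    have : (C 2 : ℝ[X]) = 2 := rfl
    rw [this]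
    ring
  rw [h, taylor_coeff, ← factorial_smul_hasseDeriv]
  simp

lemma legendrePoly_derivative_eval (l m : ℕ) (x : ℝ) :
    (derivative^[m] (legendrePoly l)).eval x =
      ((l + m).factorial : ℝ) / (2 ^ l * l.factorial) *
        (quadPow l (x ^ 2 - 1) (2 * x) 1).coeff (l + m) := by
  rw [legendrePoly, iterate_derivative_C_mul, ← Function.iterate_add_apply, eval_mul, eval_C,
    add_comm m l, iterate_derivative_eval]
  ring

/-- The derivatives of `(x² - 1) ^ l` of the orders `l - m` and `l + m` are proportional, by the
symmetry of the coefficients of the generating polynomial. -/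
lemma iterate_derivative_symm (l m : ℕ) (hm : m ≤ l) (x : ℝ) :
    (derivative^[l - m] ((X ^ 2 - 1 : ℝ[X]) ^ l)).eval x =
      ((l - m).factorial : ℝ) / (l + m).factorial * (x ^ 2 - 1) ^ m *
        (derivative^[l + m] ((X ^ 2 - 1 : ℝ[X]) ^ l)).eval x := by
  have h : ((l + m).factorial : ℝ) ≠ 0 := by positivity
  rw [iterate_derivative_eval, iterate_derivative_eval, quadPow_coeff_sub l m hm, mul_one]
  field_simp

lemma iterate_derivative_eval_eq_zero (l k : ℕ) (hk : k < l) (x : ℝ) (hx : x ^ 2 = 1) :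
    (derivative^[k] ((X ^ 2 - 1 : ℝ[X]) ^ l)).eval x = 0 := by
  rw [iterate_derivative_eval, hx, sub_self, quadPow_zero_left, coeff_X_pow_mul',
    if_neg (by omega), mul_zero]

/-- Repeated integration by parts; the boundary terms vanish since `(x² - 1) ^ l` has zeros of order
`l` at `±1`. -/
lemma integral_iterate_derivative_mul (l j : ℕ) (hj : j ≤ l) (k : ℕ) :
    ∫ x in (-1 : ℝ)..1, (derivative^[j] ((X ^ 2 - 1 : ℝ[X]) ^ l)).eval x *
        (derivative^[k] ((X ^ 2 - 1 : ℝ[X]) ^ l)).eval x =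
      (-1) ^ j * ∫ x in (-1 : ℝ)..1, (x ^ 2 - 1) ^ l *
        (derivative^[j + k] ((X ^ 2 - 1 : ℝ[X]) ^ l)).eval x := by
  induction j generalizing k with
  | zero => simp
  | succ j ih =>
    have key := intervalIntegral.integral_mul_deriv_eq_deriv_mul (a := (-1 : ℝ)) (b := 1)
      (u := fun x => (derivative^[k] ((X ^ 2 - 1 : ℝ[X]) ^ l)).eval x)
      (v := fun x => (derivative^[j] ((X ^ 2 - 1 : ℝ[X]) ^ l)).eval x)
      (u' := fun x => (derivative^[k + 1] ((X ^ 2 - 1 : ℝ[X]) ^ l)).eval x)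
      (v' := fun x => (derivative^[j + 1] ((X ^ 2 - 1 : ℝ[X]) ^ l)).eval x)
      (fun x _ => by
        rw [Function.iterate_succ_apply']; exact Polynomial.hasDerivAt _ x)
      (fun x _ => by
        rw [Function.iterate_succ_apply']; exact Polynomial.hasDerivAt _ x)
      (Polynomial.continuous _).continuousOn.intervalIntegrable
      (Polynomial.continuous _).continuousOn.intervalIntegrable
    rw [iterate_derivative_eval_eq_zero l j (by omega) 1 (by norm_num),
      iterate_derivative_eval_eq_zero l j (by omega) (-1) (by norm_num)] at key
    have ih' := ih (by omega) (k + 1)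
    simp only [mul_comm (eval _ (derivative^[j + 1] _))]
    rw [key]
    simp only [mul_comm (eval _ (derivative^[k + 1] _))]
    rw [ih', show j + (k + 1) = j + 1 + k by ring]
    ring

lemma integral_cos_comp (f : ℝ → ℝ) (hf : Continuous f) :
    ∫ θ in (0 : ℝ)..Real.pi, f (Real.cos θ) * Real.sin θ = ∫ x in (-1 : ℝ)..1, f x := by
  have h := intervalIntegral.integral_comp_mul_deriv (a := 0) (b := Real.pi)
    (f := Real.cos) (f' := fun x => - Real.sin x) (g := f)
    (fun x _ => Real.hasDerivAt_cos x) (by fun_prop) hf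
  simp only [Real.cos_zero, Real.cos_pi, Function.comp, mul_neg,
    intervalIntegral.integral_neg] at h
  rw [intervalIntegral.integral_symm 1 (-1), ← h, neg_neg]

lemma prod_two_mul_div (n : ℕ) :
    2 * ∏ i ∈ Finset.range n, (2 * (i : ℝ) + 2) / (2 * i + 3) =
      2 ^ (2 * n + 1) * (n.factorial : ℝ) ^ 2 / ((2 * n + 1).factorial : ℝ) := by
  induction n with
  | zero => simp
  | succ n ih =>
    rw [Finset.prod_range_succ, ← mul_assoc, ih,
      show 2 * (n + 1) + 1 = (2 * n + 1) + 1 + 1 by ring, Nat.factorial_succ (2 * n + 1 + 1),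
      Nat.factorial_succ (2 * n + 1), Nat.factorial_succ n]
    have : ((2 * n + 1).factorial : ℝ) ≠ 0 := by positivity
    push_cast
    field_simp
    ring

lemma integral_sq_sub_one_pow (l : ℕ) :
    ∫ x in (-1 : ℝ)..1, (x ^ 2 - 1) ^ l =
      (-1) ^ l * (2 ^ (2 * l + 1) * (l.factorial : ℝ) ^ 2 / ((2 * l + 1).factorial : ℝ)) := by
  rw [← integral_cos_comp (fun x => (x ^ 2 - 1) ^ l) (by fun_prop), ← prod_two_mul_div,
    ← integral_sin_pow_odd, ← intervalIntegral.integral_const_mul]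
  congr 1
  ext θ
  have : Real.cos θ ^ 2 - 1 = - Real.sin θ ^ 2 := by
    rw [Real.cos_sq']; ring
  rw [this, neg_pow, ← pow_mul, pow_succ]
  ring

/-- The squared norm of the Ferrers function of order `m ≥ 0`. -/
lemma integral_legendre_sq (l m : ℕ) (hm : m ≤ l) :
    ∫ x in (-1 : ℝ)..1, (1 - x ^ 2) ^ m * ((derivative^[m] (legendrePoly l)).eval x) ^ 2 =
      2 / (2 * l + 1) * (((l + m).factorial : ℝ) / ((l - m).factorial : ℝ)) := by
  have h1 : ∀ x : ℝ, (1 - x ^ 2) ^ m * ((derivative^[m] (legendrePoly l)).eval x) ^ 2 =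
      ((-1) ^ m * ((l + m).factorial / (l - m).factorial) * (1 / (2 ^ l * l.factorial)) ^ 2) *
      ((derivative^[l - m] ((X ^ 2 - 1 : ℝ[X]) ^ l)).eval x *
        (derivative^[l + m] ((X ^ 2 - 1 : ℝ[X]) ^ l)).eval x) := by
    intro x
    rw [iterate_derivative_symm l m hm, legendrePoly, iterate_derivative_C_mul,
      ← Function.iterate_add_apply, eval_mul, eval_C, add_comm m l,
      show (1 - x ^ 2) = (-1) * (x ^ 2 - 1) by ring, mul_pow]
    have h : ((l + m).factorial : ℝ) ≠ 0 := by positivity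
    have h' : ((l - m).factorial : ℝ) ≠ 0 := by positivity
    field_simp
  have h2 : ∀ x : ℝ, (derivative^[l - m + (l + m)] ((X ^ 2 - 1 : ℝ[X]) ^ l)).eval x =
      (2 * l).factorial := by
    intro x
    rw [show l - m + (l + m) = 2 * l by omega, iterate_derivative_eval, quadPow_coeff_two_mul]
    simp
  simp only [h1]
  rw [intervalIntegral.integral_const_mul, integral_iterate_derivative_mul l (l - m) (by omega)]
  simp only [h2]
  rw [intervalIntegral.integral_mul_const, integral_sq_sub_one_pow, Nat.factorial_succ (2 * l)]
  have h : ((l + m).factorial : ℝ) ≠ 0 := by positivity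
  have h' : ((l - m).factorial : ℝ) ≠ 0 := by positivity
  have h3 : ((2 * l).factorial : ℝ) ≠ 0 := by positivity
  have h4 : (-1 : ℝ) ^ m * (-1) ^ (l - m) * (-1) ^ l = 1 := by
    rw [← pow_add, ← pow_add, show m + (l - m) + l = 2 * l by omega, pow_mul]
    simp
  push_cast
  have h5 : (2 : ℝ) ^ (2 * l + 1) = 2 * (2 ^ l) ^ 2 := by ring
  rw [h5]
  calc _ = ((-1 : ℝ) ^ m * (-1) ^ (l - m) * (-1) ^ l) *
      (2 / (2 * l + 1) * ((l + m).factorial / (l - m).factorial)) := by field_simp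
    _ = _ := by rw [h4, one_mul]

/-! ### Solid harmonics as coefficients of powers of null linear forms -/

/-- The complex number `x₀ + i x₁`. -/
def planar (x : E3) : ℂ := ⟨x 0, x 1⟩

/-- The generating polynomial `(-conj u + 2 z X + u X²) ^ l` of the solid harmonics of degree `l`,
where `u = x₀ + i x₁` and `z = x₂`. Its value at `s` is the `l`-th power of the linear form of `x`
with the isotropic coefficient vector `(s² - 1, i (s² + 1), 2 s)`. -/
def solidGen (l : ℕ) (x : E3) : ℂ[X] :=
  quadPow l (-(starRingEnd ℂ) (planar x)) (2 * (x 2 : ℂ)) (planar x)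

/-- The factor between the spherical harmonic `Y_{l,m}` and the coefficient of `solidGen`. -/
def harmConst (l : ℕ) (m : ℤ) : ℂ :=
  (-1) ^ m * (Real.sqrt ((((l : ℤ) - m).toNat.factorial : ℝ) * (((l : ℤ) + m).toNat.factorial : ℝ) *
    (2 * l + 1) / (4 * Real.pi)) : ℝ) / (2 ^ l * l.factorial)

lemma neg_one_zpow_neg (m : ℤ) : (-1 : ℂ) ^ (-m) = (-1) ^ m := by
  rw [zpow_neg, ← inv_zpow, inv_neg, inv_one]

lemma harmConst_neg (l : ℕ) (m : ℤ) : harmConst l (-m) = harmConst l m := by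
  rw [harmConst, harmConst, neg_one_zpow_neg, sub_neg_eq_add, ← sub_eq_add_neg,
    mul_comm (((l : ℤ) + m).toNat.factorial : ℝ)]

lemma harmConst_ne_zero (l : ℕ) (m : ℤ) : harmConst l m ≠ 0 := by
  have h : (Real.sqrt ((((l : ℤ) - m).toNat.factorial : ℝ) *
    (((l : ℤ) + m).toNat.factorial : ℝ) * (2 * l + 1) / (4 * Real.pi))) ≠ 0 := by
    have := Real.pi_pos
    positivity
  rw [harmConst]
  refine div_ne_zero (mul_ne_zero (zpow_ne_zero _ (by norm_num)) (by exact_mod_cast h)) ?_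
  have : (2 : ℂ) ^ l * l.factorial = ((2 ^ l * l.factorial : ℕ) : ℂ) := by push_cast; rfl
  rw [this]
  exact_mod_cast (by positivity : (2 ^ l * l.factorial : ℕ) ≠ 0)

lemma planar_mul_conj (x : E3) :
    -(starRingEnd ℂ) (planar x) * planar x = ((-(x 0 ^ 2 + x 1 ^ 2) : ℝ) : ℂ) := by
  rw [neg_mul, ← Complex.normSq_eq_conj_mul_self, Complex.normSq_apply]
  simp only [planar]
  push_cast
  ring

/-- The common real factor of the coefficients of `solidGen` of the orders `l - n` and `l + n`. -/
def solidCoeff (l n : ℕ) (x : E3) : ℝ :=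
  (quadPow l (-(x 0 ^ 2 + x 1 ^ 2)) (2 * x 2) 1).coeff (l + n)

lemma solidCoeff_cast (l n : ℕ) (x : E3) :
    (quadPow l (-(starRingEnd ℂ) (planar x) * planar x) (2 * (x 2 : ℂ)) 1).coeff (l + n) =
      (solidCoeff l n x : ℂ) := by
  have h := quadPow_map Complex.ofRealHom l (-(x 0 ^ 2 + x 1 ^ 2)) (2 * x 2) 1
  have h2 := congrArg (fun p => p.coeff (l + n)) h
  simp only [coeff_map] at h2
  rw [planar_mul_conj, solidCoeff]
  refine Eq.trans ?_ h2.symm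
  simp

lemma solidGen_coeff_add (l n : ℕ) (x : E3) :
    (solidGen l x).coeff (l + n) = planar x ^ n * solidCoeff l n x := by
  rw [solidGen, quadPow_coeff_add, solidCoeff_cast]

lemma solidGen_coeff_sub (l n : ℕ) (hn : n ≤ l) (x : E3) :
    (solidGen l x).coeff (l - n) = (-(starRingEnd ℂ) (planar x)) ^ n * solidCoeff l n x := by
  rw [solidGen, quadPow_coeff_sub l n hn, solidCoeff_cast]

lemma planar_smul (r : ℝ) (x : E3) : planar (r • x) = r * planar x := by
  apply Complex.ext <;> simp [planar]

lemma solidGen_smul (l : ℕ) (r : ℝ) (x : E3) :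
    solidGen l (r • x) = C ((r : ℂ) ^ l) * solidGen l x := by
  rw [solidGen, solidGen, ← quadPow_smul, planar_smul]
  congr 1
  · simp
  · simp; ring

lemma planar_unitVec (θ φ : ℝ) :
    planar (unitVec θ φ) = Real.sin θ * Complex.exp (Complex.I * φ) := by
  rw [mul_comm Complex.I, Complex.exp_mul_I]
  apply Complex.ext <;>
    simp [planar, unitVec, ← Complex.ofReal_cos, ← Complex.ofReal_sin]

lemma solidCoeff_unitVec (l n : ℕ) (θ φ : ℝ) :
    solidCoeff l n (unitVec θ φ) =
      (quadPow l (Real.cos θ ^ 2 - 1) (2 * Real.cos θ) 1).coeff (l + n) := by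
  have : -((unitVec θ φ) 0 ^ 2 + (unitVec θ φ) 1 ^ 2) = Real.cos θ ^ 2 - 1 := by
    simp only [unitVec, Matrix.cons_val_zero, Matrix.cons_val_one]
    have h1 := Real.sin_sq_add_cos_sq θ
    have h2 := Real.sin_sq_add_cos_sq φ
    linear_combination (-Real.sin θ ^ 2) * h2 - h1
  rw [solidCoeff, this]
  rfl

lemma sqrt_mul_factorial (a b t : ℝ) (ha : 0 < a) (hb : 0 < b) :
    Real.sqrt (a * t / (4 * Real.pi * b)) * b = Real.sqrt (a * b * t / (4 * Real.pi)) := by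
  have := Real.pi_pos
  conv_lhs => rw [← Real.sqrt_sq hb.le]
  rw [← Real.sqrt_mul' _ (sq_nonneg b), Real.sqrt_sq hb.le]
  congr 1
  field_simp

/-- On the unit sphere, the spherical harmonic `Y_{l,m}` is a multiple of the coefficient of order
`l + m` of the generating polynomial. -/
lemma sphY_eq_coeff (l : ℕ) (m : ℤ) (hm : m ∈ Finset.Icc (-(l : ℤ)) l) (θ φ : ℝ)
    (hθ : 0 ≤ Real.sin θ) :
    sphY l m θ φ = harmConst l m * (solidGen l (unitVec θ φ)).coeff ((l : ℤ) + m).toNat := by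
  rw [Finset.mem_Icc] at hm
  have hs : Real.sqrt (1 - Real.cos θ ^ 2) = Real.sin θ := by
    rw [← Real.abs_sin_eq_sqrt_one_sub_cos_sq, abs_of_nonneg hθ]
  have h2 : (2 : ℂ) ^ l * l.factorial ≠ 0 := by
    exact_mod_cast (by positivity : (2 ^ l * l.factorial : ℕ) ≠ 0)
  rcases m with n | n
  · have e1 : ((l : ℤ) - Int.ofNat n).toNat = l - n := by simp only [Int.ofNat_eq_natCast]; omega
    have e2 : ((l : ℤ) + Int.ofNat n).toNat = l + n := by simp only [Int.ofNat_eq_natCast]; omega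
    have key := congrArg Complex.ofReal (sqrt_mul_factorial ((l - n).factorial : ℝ)
      ((l + n).factorial : ℝ) (2 * l + 1) (by positivity) (by positivity))
    simp only [sphY, harmConst, ferrers, e1, e2, hs, legendrePoly_derivative_eval,
      solidGen_coeff_add, solidCoeff_unitVec, planar_unitVec]
    rw [← key]
    push_cast
    rw [mul_pow, ← Complex.exp_nat_mul]
    have : Complex.exp (Complex.I * ((Int.ofNat n : ℤ) : ℂ) * φ) =
        Complex.exp (n * (Complex.I * φ)) := by
      congr 1; simp; ring
    simp only [Int.ofNat_eq_natCast, Int.cast_natCast, zpow_natCast] at this ⊢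
    rw [this]
    field_simp
  · have hn : n + 1 ≤ l := by have := hm.1; rw [Int.negSucc_eq] at this; omega
    have e1 : ((l : ℤ) - Int.negSucc n).toNat = l + (n + 1) := by rw [Int.negSucc_eq]; omega
    have e2 : ((l : ℤ) + Int.negSucc n).toNat = l - (n + 1) := by rw [Int.negSucc_eq]; omega
    have key := congrArg Complex.ofReal (sqrt_mul_factorial ((l + (n + 1)).factorial : ℝ)
      ((l - (n + 1)).factorial : ℝ) (2 * l + 1) (by positivity) (by positivity))
    simp only [sphY, harmConst, ferrers, e1, e2, hs, legendrePoly_derivative_eval,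
      solidGen_coeff_sub l (n + 1) hn, solidCoeff_unitVec, planar_unitVec]
    rw [← key]
    have h3 : (((l + (n + 1)).factorial : ℕ) : ℂ) ≠ 0 := by
      exact_mod_cast (Nat.factorial_pos _).ne'
    have hc : (starRingEnd ℂ) (Real.sin θ * Complex.exp (Complex.I * φ)) =
        Real.sin θ * Complex.exp (-(Complex.I * φ)) := by
      rw [map_mul, Complex.conj_ofReal, ← Complex.exp_conj, map_mul, Complex.conj_I,
        Complex.conj_ofReal, neg_mul]
    have hz : (-1 : ℂ) ^ (Int.negSucc n) = (-1) ^ (n + 1) := by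
      rw [zpow_negSucc, ← inv_pow, inv_neg, inv_one]
    have : Complex.exp (Complex.I * ((Int.negSucc n : ℤ) : ℂ) * φ) =
        Complex.exp (-(Complex.I * φ)) ^ (n + 1) := by
      rw [← Complex.exp_nat_mul]
      congr 1; rw [Int.negSucc_eq]; push_cast; ring
    rw [hc, hz, this, neg_pow (_ * _), mul_pow]
    push_cast
    have h4 : ((-1 : ℂ) ^ (n + 1)) * (-1) ^ (n + 1) = 1 := by
      rw [← mul_pow]; simp
    field_simp

lemma norm_sq_eq (x : E3) : ‖x‖ ^ 2 = x 0 ^ 2 + x 1 ^ 2 + x 2 ^ 2 := by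
  rw [EuclideanSpace.real_norm_sq_eq, Fin.sum_univ_three]

lemma sin_polarAngle_nonneg (x : E3) : 0 ≤ Real.sin (polarAngle x) :=
  Real.sin_nonneg_of_nonneg_of_le_pi (Real.arccos_nonneg _) (Real.arccos_le_pi _)

lemma norm_smul_unitVec (x : E3) (hx : x ≠ 0) :
    ‖x‖ • unitVec (polarAngle x) (azimuth x) = x := by
  have h0 : 0 < ‖x‖ := norm_pos_iff.mpr hx
  have hsq := norm_sq_eq x
  have hz : |x 2| ≤ ‖x‖ := abs_le_of_sq_le_sq (by nlinarith [sq_nonneg (x 0), sq_nonneg (x 1)]) h0.le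
  have hz' := abs_le.mp hz
  have hcos : Real.cos (polarAngle x) = x 2 / ‖x‖ := by
    rw [polarAngle, Real.cos_arccos]
    · rw [le_div_iff₀ h0]; linarith
    · rw [div_le_iff₀ h0]; linarith
  have hsin : ‖x‖ * Real.sin (polarAngle x) = ‖planar x‖ := by
    rw [polarAngle, Real.sin_arccos, Complex.norm_eq_sqrt_sq_add_sq]
    conv_lhs => rw [← Real.sqrt_sq h0.le]
    rw [← Real.sqrt_mul (sq_nonneg _), Real.sqrt_sq h0.le]
    congr 1
    simp only [planar]
    field_simp
    linarith
  ext i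
  fin_cases i
  · simp [unitVec, azimuth]
    rw [← mul_assoc, hsin]; exact Complex.norm_mul_cos_arg (planar x)
  · simp [unitVec, azimuth]
    rw [← mul_assoc, hsin]; exact Complex.norm_mul_sin_arg (planar x)
  · simp [unitVec, hcos]
    field_simp

/-- Off the origin, `Y_{l,m}` as a function of vectors is homogeneous of degree zero, and
proportional to a solid harmonic on each sphere. -/
lemma onVec_sphY_eq (l : ℕ) (m : ℤ) (hm : m ∈ Finset.Icc (-(l : ℤ)) l) (x : E3) (hx : x ≠ 0) :
    onVec (sphY l m) x =
      harmConst l m * ((‖x‖ : ℂ) ^ l)⁻¹ * (solidGen l x).coeff ((l : ℤ) + m).toNat := by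
  have h0 : (‖x‖ : ℂ) ^ l ≠ 0 := pow_ne_zero _ (by exact_mod_cast (norm_pos_iff.mpr hx).ne')
  conv_rhs => rw [← norm_smul_unitVec x hx, solidGen_smul, coeff_C_mul, norm_smul_unitVec x hx]
  rw [onVec, sphY_eq_coeff l m hm _ _ (sin_polarAngle_nonneg x)]
  field_simp

lemma norm_unitVec (θ φ : ℝ) : ‖unitVec θ φ‖ = 1 := by
  have h : ‖unitVec θ φ‖ ^ 2 = 1 := by
    rw [norm_sq_eq]
    simp only [unitVec, Matrix.cons_val_zero, Matrix.cons_val_one, Matrix.cons_val]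
    have h1 := Real.sin_sq_add_cos_sq θ
    have h2 := Real.sin_sq_add_cos_sq φ
    linear_combination Real.sin θ ^ 2 * h2 + h1
  exact (pow_eq_one_iff_of_nonneg (norm_nonneg _) two_ne_zero).mp h

lemma unitVec_ne_zero (θ φ : ℝ) : unitVec θ φ ≠ 0 := by
  intro h
  have := norm_unitVec θ φ
  rw [h, norm_zero] at this
  exact zero_ne_one this

lemma onVec_sphY_unitVec (l : ℕ) (m : ℤ) (hm : m ∈ Finset.Icc (-(l : ℤ)) l) (θ φ : ℝ)
    (hθ : 0 ≤ Real.sin θ) : onVec (sphY l m) (unitVec θ φ) = sphY l m θ φ := by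
  rw [onVec_sphY_eq l m hm _ (unitVec_ne_zero θ φ), sphY_eq_coeff l m hm θ φ hθ, norm_unitVec]
  simp

/-- `conj Y_{l,m} = (-1)^m Y_{l,-m}`. -/
lemma conj_sphY (l : ℕ) (m : ℤ) (hm : m ∈ Finset.Icc (-(l : ℤ)) l) (θ φ : ℝ)
    (hθ : 0 ≤ Real.sin θ) : (starRingEnd ℂ) (sphY l m θ φ) = (-1) ^ m * sphY l (-m) θ φ := by
  have hK : (starRingEnd ℂ) (harmConst l m) = harmConst l m := by
    simp [harmConst, map_zpow₀, Complex.conj_ofNat]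
  have hm' : -m ∈ Finset.Icc (-(l : ℤ)) l := by
    rw [Finset.mem_Icc] at hm ⊢; omega
  rw [sphY_eq_coeff l m hm θ φ hθ, sphY_eq_coeff l (-m) hm' θ φ hθ, harmConst_neg, map_mul, hK]
  rw [Finset.mem_Icc] at hm
  have h1 : ∀ n : ℕ, (-1 : ℂ) ^ n * (-1) ^ n = 1 := fun n => by rw [← mul_pow]; simp
  rcases Int.eq_nat_or_neg m with ⟨n, rfl | rfl⟩
  · have e1 : ((l : ℤ) + n).toNat = l + n := by omega
    have e2 : ((l : ℤ) + -(n : ℤ)).toNat = l - n := by omega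
    rw [e1, e2, solidGen_coeff_add, solidGen_coeff_sub l n (by omega), neg_pow, map_mul, map_pow,
      Complex.conj_ofReal, zpow_natCast]
    linear_combination (-harmConst l n * (starRingEnd ℂ) (planar (unitVec θ φ)) ^ n *
      (solidCoeff l n (unitVec θ φ))) * h1 n
  · have e1 : ((l : ℤ) + -(n : ℤ)).toNat = l - n := by omega
    have e2 : ((l : ℤ) + - -(n : ℤ)).toNat = l + n := by omega
    have hz : (-1 : ℂ) ^ (-(n : ℤ)) = (-1) ^ n := by
      rw [neg_one_zpow_neg, zpow_natCast]
    rw [e1, e2, solidGen_coeff_add, solidGen_coeff_sub l n (by omega), neg_pow, map_mul, map_mul,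
      map_pow, map_pow, Complex.conj_ofReal, hz]
    simp
    ring

/-! ### Rotation invariance -/

lemma natDegree_solidGen_le (l : ℕ) (x : E3) : (solidGen l x).natDegree ≤ 2 * l :=
  natDegree_quadPow_le _ _ _ _

lemma solidGen_eval_eq_sum (l : ℕ) (x : E3) (s : ℂ) :
    (solidGen l x).eval s = ∑ k ∈ Finset.range (2 * l + 1), (solidGen l x).coeff k * s ^ k :=
  eval_eq_sum_range' (Nat.lt_succ_of_le (natDegree_solidGen_le l x)) s

/-- The `l`-th power of a linear form whose coefficient vector is isotropic (`4 a c + b² = 0` in the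
coordinates `u`, `z`, `conj u`) is a combination of the solid harmonics of degree `l`: the isotropic
vectors are the multiples of those in `solidGen` and of the limiting one as `s → ∞`. -/
lemma isotropic_pow_eq_sum (l : ℕ) (a b c : ℂ) (h : 4 * a * c + b ^ 2 = 0) :
    ∃ d : ℕ → ℂ, ∀ x : E3, (a * planar x + b * x 2 + c * (starRingEnd ℂ) (planar x)) ^ l =
      ∑ k ∈ Finset.range (2 * l + 1), d k * (solidGen l x).coeff k := by
  by_cases hc : c = 0
  · subst hc
    have hb : b = 0 := by simpa using h
    subst hb
    refine ⟨fun k => if k = 2 * l then a ^ l else 0, fun x => ?_⟩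
    simp only [ite_mul, zero_mul, Finset.sum_ite_eq', Finset.mem_range]
    rw [if_pos (by omega), solidGen, quadPow_coeff_two_mul]
    simp [mul_pow]
  · refine ⟨fun k => (-c) ^ l * (-b / (2 * c)) ^ k, fun x => ?_⟩
    have e : a = -b ^ 2 / (4 * c) := by
      field_simp
      linear_combination h
    simp only [mul_assoc]
    rw [← Finset.mul_sum]
    simp only [mul_comm ((-b / (2 * c)) ^ _)]
    rw [← solidGen_eval_eq_sum, solidGen, quadPow_eval, ← mul_pow]
    congr 1
    rw [e]
    field_simp
    ring

/-- A coefficient of a polynomial of degree at most `2 l` is a fixed combination of its values at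
`0, …, 2 l`. -/
lemma coeff_eq_sum_eval (l : ℕ) (k : ℕ) : ∃ w : ℕ → ℂ, ∀ p : ℂ[X], p.natDegree ≤ 2 * l →
    p.coeff k = ∑ i ∈ Finset.range (2 * l + 1), w i * p.eval (i : ℂ) := by
  refine ⟨fun i => (Lagrange.basis (Finset.range (2 * l + 1)) (fun n : ℕ => (n : ℂ)) i).coeff k,
    fun p hp => ?_⟩
  have hd : p.degree < ((Finset.range (2 * l + 1)).card : ℕ) := by
    rw [Finset.card_range]
    exact lt_of_le_of_lt degree_le_natDegree (by exact_mod_cast Nat.lt_succ_of_le hp)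
  have h := Lagrange.eq_interpolate (s := Finset.range (2 * l + 1)) (v := fun n : ℕ => (n : ℂ))
    (f := p) (Nat.cast_injective.injOn) hd
  conv_lhs => rw [h, Lagrange.interpolate_apply, finsetSum_coeff]
  refine Finset.sum_congr rfl fun i _ => ?_
  rw [coeff_C_mul, mul_comm]

lemma toEuclideanLin_apply_eq (Q : Matrix (Fin 3) (Fin 3) ℝ) (x : E3) (i : Fin 3) :
    Matrix.toEuclideanLin Q x i = Q i 0 * x 0 + Q i 1 * x 1 + Q i 2 * x 2 := by
  simp [Matrix.toEuclideanLin, Matrix.mulVec, dotProduct, Fin.sum_univ_three]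

/-- Rotating `x` transforms the isotropic linear form in `solidGen` into another isotropic one. -/
lemma solidGen_rotate_eval (l : ℕ) (Q : Matrix (Fin 3) (Fin 3) ℝ) (hQ : Q * Q.transpose = 1)
    (s : ℂ) : ∃ d : ℕ → ℂ, ∀ x : E3, (solidGen l (Matrix.toEuclideanLin Q x)).eval s =
      ∑ k ∈ Finset.range (2 * l + 1), d k * (solidGen l x).coeff k := by
  -- `b` is the coefficient vector of the rotated linear form.
  set b : Fin 3 → ℂ := fun j =>
    (s ^ 2 - 1) * Q 0 j + Complex.I * (s ^ 2 + 1) * Q 1 j + 2 * s * Q 2 j with hb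
  have hQ' : ∀ i j, (Q i 0 * Q j 0 + Q i 1 * Q j 1 + Q i 2 * Q j 2 : ℂ) =
      if i = j then 1 else 0 := by
    intro i j
    have := congrFun (congrFun hQ i) j
    rw [Matrix.mul_apply, Fin.sum_univ_three, Matrix.one_apply] at this
    simp only [Matrix.transpose_apply] at this
    have := congrArg Complex.ofReal this
    push_cast at this
    rw [this]
    split_ifs <;> simp
  have hnull : b 0 ^ 2 + b 1 ^ 2 + b 2 ^ 2 = 0 := by
    have h00 := hQ' 0 0
    have h11 := hQ' 1 1
    have h22 := hQ' 2 2
    have h01 := hQ' 0 1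
    have h02 := hQ' 0 2
    have h12 := hQ' 1 2
    simp at h00 h11 h22 h01 h02 h12
    have hI := Complex.I_sq
    simp only [hb]
    linear_combination (s ^ 2 - 1) ^ 2 * h00 + Complex.I ^ 2 * (s ^ 2 + 1) ^ 2 * h11 +
      4 * s ^ 2 * h22 + 2 * (s ^ 2 - 1) * Complex.I * (s ^ 2 + 1) * h01 +
      2 * (s ^ 2 - 1) * (2 * s) * h02 + 2 * Complex.I * (s ^ 2 + 1) * (2 * s) * h12 +
      (s ^ 2 + 1) ^ 2 * hI
  obtain ⟨d, hd⟩ := isotropic_pow_eq_sum l ((b 0 - Complex.I * b 1) / 2) (b 2)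
    ((b 0 + Complex.I * b 1) / 2) (by
      linear_combination hnull - b 1 ^ 2 * Complex.I_sq)
  refine ⟨d, fun x => ?_⟩
  rw [← hd x, solidGen, quadPow_eval]
  congr 1
  have hp : ∀ y : E3, planar y = y 0 + y 1 * Complex.I := fun y => by
    apply Complex.ext <;> simp [planar]
  have hp' : ∀ y : E3, (starRingEnd ℂ) (planar y) = y 0 - y 1 * Complex.I := fun y => by
    rw [hp]; simp; ring
  rw [hp', hp', hp, hp]
  simp only [toEuclideanLin_apply_eq, hb]
  push_cast
  have hI := Complex.I_sq
  linear_combination (-(x 1 : ℂ) * ((s ^ 2 - 1) * Q 0 1 + Complex.I * (s ^ 2 + 1) * Q 1 1 +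
    2 * s * Q 2 1) * (-1)) * hI

lemma solidGen_rotate (l : ℕ) (Q : Matrix (Fin 3) (Fin 3) ℝ) (hQ : Q * Q.transpose = 1)
    (k : ℕ) : ∃ d : ℕ → ℂ, ∀ x : E3, (solidGen l (Matrix.toEuclideanLin Q x)).coeff k =
      ∑ k' ∈ Finset.range (2 * l + 1), d k' * (solidGen l x).coeff k' := by
  obtain ⟨w, hw⟩ := coeff_eq_sum_eval l k
  choose d hd using fun i : ℕ => solidGen_rotate_eval l Q hQ (i : ℂ)
  refine ⟨fun k' => ∑ i ∈ Finset.range (2 * l + 1), w i * d i k', fun x => ?_⟩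
  rw [hw _ (natDegree_solidGen_le l _)]
  simp only [hd, Finset.mul_sum, Finset.sum_mul]
  rw [Finset.sum_comm]
  simp only [mul_assoc]

lemma sum_range_eq_sum_Icc (l : ℕ) (f : ℕ → ℂ) :
    ∑ k ∈ Finset.range (2 * l + 1), f k =
      ∑ m ∈ Finset.Icc (-(l : ℤ)) l, f ((l : ℤ) + m).toNat := by
  refine Finset.sum_nbij' (fun k => (k : ℤ) - l) (fun m => ((l : ℤ) + m).toNat) ?_ ?_ ?_ ?_ ?_
  all_goals simp only [Finset.mem_range, Finset.mem_Icc]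
  · intro a ha; omega
  · intro a ha; omega
  · intro a ha; omega
  · intro a ha; omega
  · intro a ha; congr 1; omega

/-- The space spanned by the spherical harmonics of degree `l` is invariant under rotations. -/
lemma exists_rotOp_sphY (l : ℕ) (m : ℤ) (hm : m ∈ Finset.Icc (-(l : ℤ)) l) (R : SO3) :
    ∃ c : ℤ → ℂ, ∀ x : E3, x ≠ 0 → rotOp R (onVec (sphY l m)) x =
      ∑ m' ∈ Finset.Icc (-(l : ℤ)) l, c m' * onVec (sphY l m') x := by
  set Q : Matrix (Fin 3) (Fin 3) ℝ := ((R⁻¹ : SO3) : Matrix (Fin 3) (Fin 3) ℝ) with hQdef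
  have hmem := (Matrix.mem_specialOrthogonalGroup_iff.mp (R⁻¹ : SO3).2).1
  have hQ : Q * Q.transpose = 1 := (Matrix.mem_orthogonalGroup_iff _ _).mp hmem
  have hQ2 : Q.transpose * Q = 1 := (Matrix.mem_orthogonalGroup_iff' _ _).mp hmem
  have hnorm : ∀ x : E3, ‖Matrix.toEuclideanLin Q x‖ = ‖x‖ := by
    intro x
    have h : ‖Matrix.toEuclideanLin Q x‖ ^ 2 = ‖x‖ ^ 2 := by
      have e : ∀ i j, Q 0 i * Q 0 j + Q 1 i * Q 1 j + Q 2 i * Q 2 j =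
          if i = j then 1 else 0 := by
        intro i j
        have := congrFun (congrFun hQ2 i) j
        rwa [Matrix.mul_apply, Fin.sum_univ_three, Matrix.one_apply] at this
      have h00 := e 0 0
      have h11 := e 1 1
      have h22 := e 2 2
      have h01 := e 0 1
      have h02 := e 0 2
      have h12 := e 1 2
      simp at h00 h11 h22 h01 h02 h12
      rw [norm_sq_eq, norm_sq_eq]
      simp only [toEuclideanLin_apply_eq]
      linear_combination x 0 ^ 2 * h00 + x 1 ^ 2 * h11 + x 2 ^ 2 * h22 + 2 * x 0 * x 1 * h01 +
        2 * x 0 * x 2 * h02 + 2 * x 1 * x 2 * h12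
    exact (sq_eq_sq₀ (norm_nonneg _) (norm_nonneg _)).mp h
  obtain ⟨d, hd⟩ := solidGen_rotate l Q hQ ((l : ℤ) + m).toNat
  refine ⟨fun m' => harmConst l m * d ((l : ℤ) + m').toNat * (harmConst l m')⁻¹, fun x hx => ?_⟩
  have hx' : Matrix.toEuclideanLin Q x ≠ 0 := by
    rw [← norm_pos_iff, hnorm, norm_pos_iff]; exact hx
  rw [rotOp, onVec_sphY_eq l m hm _ hx', hd, hnorm, sum_range_eq_sum_Icc, Finset.mul_sum]
  refine Finset.sum_congr rfl fun m' hm' => ?_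
  rw [onVec_sphY_eq l m' hm' x hx]
  have := harmConst_ne_zero l m'
  field_simp

/-! ### Orthonormality and the Wigner coefficients -/

lemma integral_exp_int (n : ℤ) :
    ∫ φ in (0 : ℝ)..(2 * Real.pi), Complex.exp (Complex.I * n * φ) =
      if n = 0 then 2 * (Real.pi : ℂ) else 0 := by
  split_ifs with h
  · subst h
    simp
  · have hc : Complex.I * (n : ℂ) ≠ 0 := mul_ne_zero Complex.I_ne_zero (by exact_mod_cast h)
    rw [integral_exp_mul_complex hc]
    have : Complex.I * n * ((2 * Real.pi : ℝ) : ℂ) = n * (2 * Real.pi * Complex.I) := by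
      push_cast; ring
    rw [this, Complex.exp_int_mul_two_pi_mul_I]
    simp

/-- The dependence of `Y_{l,m}` on the polar angle. -/
def polarPart (l : ℕ) (m : ℤ) (θ : ℝ) : ℝ :=
  Real.sqrt ((((l : ℤ) - m).toNat.factorial : ℝ) * (2 * l + 1) /
      (4 * Real.pi * (((l : ℤ) + m).toNat.factorial : ℝ))) * ferrers l m (Real.cos θ)

lemma sphY_eq_polarPart (l : ℕ) (m : ℤ) (θ φ : ℝ) :
    sphY l m θ φ = polarPart l m θ * Complex.exp (Complex.I * m * φ) := by
  rw [sphY, polarPart]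
  push_cast
  ring

lemma integral_conj_sphY_mul (l : ℕ) (m m' : ℤ) (θ : ℝ) :
    ∫ φ in (0 : ℝ)..(2 * Real.pi), (starRingEnd ℂ) (sphY l m' θ φ) * sphY l m θ φ =
      if m = m' then ((2 * Real.pi * polarPart l m θ ^ 2 : ℝ) : ℂ) else 0 := by
  have h : ∀ φ : ℝ, (starRingEnd ℂ) (sphY l m' θ φ) * sphY l m θ φ =
      ((polarPart l m' θ : ℂ) * polarPart l m θ) *
        Complex.exp (Complex.I * ((m - m' : ℤ) : ℂ) * φ) := by
    intro φ
    have e : (starRingEnd ℂ) (Complex.exp (Complex.I * m' * φ)) =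
        Complex.exp (-(Complex.I * m' * φ)) := by
      rw [← Complex.exp_conj]
      simp
    rw [sphY_eq_polarPart, sphY_eq_polarPart, map_mul, Complex.conj_ofReal, e, mul_mul_mul_comm,
      ← Complex.exp_add]
    congr 2
    push_cast
    ring
  simp only [h]
  rw [intervalIntegral.integral_const_mul, integral_exp_int]
  simp only [sub_eq_zero]
  split_ifs with h1
  · subst h1
    push_cast
    ring
  · simp

lemma sqrt_one_sub_cos_sq_pow (θ : ℝ) (n : ℕ) :
    (Real.sqrt (1 - Real.cos θ ^ 2) ^ n) ^ 2 = (1 - Real.cos θ ^ 2) ^ n := by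
  rw [← pow_mul, mul_comm, pow_mul, Real.sq_sqrt]
  nlinarith [Real.cos_sq_le_one θ]

lemma integral_ferrers_sq (l : ℕ) (m : ℤ) (hm : m ∈ Finset.Icc (-(l : ℤ)) l) :
    ∫ θ in (0 : ℝ)..Real.pi, ferrers l m (Real.cos θ) ^ 2 * Real.sin θ =
      2 / (2 * l + 1) *
        ((((l : ℤ) + m).toNat.factorial : ℝ) / (((l : ℤ) - m).toNat.factorial : ℝ)) := by
  rw [Finset.mem_Icc] at hm
  have key : ∀ n : ℕ, n ≤ l →
      ∫ θ in (0 : ℝ)..Real.pi, (1 - Real.cos θ ^ 2) ^ n *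
          ((derivative^[n] (legendrePoly l)).eval (Real.cos θ)) ^ 2 * Real.sin θ =
        2 / (2 * l + 1) * (((l + n).factorial : ℝ) / ((l - n).factorial : ℝ)) := fun n hn => by
    rw [← integral_legendre_sq l n hn]
    exact integral_cos_comp
      (fun x => (1 - x ^ 2) ^ n * ((derivative^[n] (legendrePoly l)).eval x) ^ 2)
      (by have := (derivative^[n] (legendrePoly l)).continuous; fun_prop)
  rcases m with n | n
  · have e1 : ((l : ℤ) - Int.ofNat n).toNat = l - n := by simp only [Int.ofNat_eq_natCast]; omega
    have e2 : ((l : ℤ) + Int.ofNat n).toNat = l + n := by simp only [Int.ofNat_eq_natCast]; omega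
    rw [e1, e2, ← key n (by have := hm.2; simp only [Int.ofNat_eq_natCast] at this; omega)]
    congr 1
    ext θ
    rw [ferrers, mul_pow, mul_pow, sqrt_one_sub_cos_sq_pow, ← pow_mul, mul_comm n 2, pow_mul]
    simp
  · have hn : n + 1 ≤ l := by have := hm.1; rw [Int.negSucc_eq] at this; omega
    have e1 : ((l : ℤ) - Int.negSucc n).toNat = l + (n + 1) := by rw [Int.negSucc_eq]; omega
    have e2 : ((l : ℤ) + Int.negSucc n).toNat = l - (n + 1) := by rw [Int.negSucc_eq]; omega
    have e3 : ∀ θ : ℝ, ferrers l (Int.negSucc n) (Real.cos θ) ^ 2 * Real.sin θ =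
        (((l - (n + 1)).factorial : ℝ) / ((l + (n + 1)).factorial : ℝ)) ^ 2 *
        ((1 - Real.cos θ ^ 2) ^ (n + 1) *
          ((derivative^[n + 1] (legendrePoly l)).eval (Real.cos θ)) ^ 2 * Real.sin θ) := by
      intro θ
      have h1 : ((-1 : ℝ) ^ (n + 1)) ^ 2 = 1 := by
        rw [← pow_mul, mul_comm, pow_mul]; simp
      rw [ferrers, mul_pow, mul_pow, mul_pow, mul_pow, sqrt_one_sub_cos_sq_pow, h1]
      ring
    simp only [e3]
    rw [intervalIntegral.integral_const_mul, key (n + 1) hn, e1, e2]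
    have h3 : ((l + (n + 1)).factorial : ℝ) ≠ 0 := by positivity
    have h4 : ((l - (n + 1)).factorial : ℝ) ≠ 0 := by positivity
    field_simp

lemma integral_polarPart_sq (l : ℕ) (m : ℤ) (hm : m ∈ Finset.Icc (-(l : ℤ)) l) :
    ∫ θ in (0 : ℝ)..Real.pi, 2 * Real.pi * polarPart l m θ ^ 2 * Real.sin θ = 1 := by
  have hpi := Real.pi_pos
  have h : ∀ θ : ℝ, 2 * Real.pi * polarPart l m θ ^ 2 * Real.sin θ =
      (2 * Real.pi * ((((l : ℤ) - m).toNat.factorial : ℝ) * (2 * l + 1) /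
      (4 * Real.pi * (((l : ℤ) + m).toNat.factorial : ℝ)))) *
        (ferrers l m (Real.cos θ) ^ 2 * Real.sin θ) := by
    intro θ
    rw [polarPart, mul_pow, Real.sq_sqrt (by positivity)]
    ring
  simp only [h]
  rw [intervalIntegral.integral_const_mul, integral_ferrers_sq l m hm]
  have h3 : (((l : ℤ) - m).toNat.factorial : ℝ) ≠ 0 := by positivity
  have h4 : (((l : ℤ) + m).toNat.factorial : ℝ) ≠ 0 := by positivity
  field_simp
  norm_num

/-- If a rotated spherical harmonic is expanded in the spherical harmonics of the same degree, the
coefficients are the Wigner coefficients, by orthonormality. -/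
lemma wignerD_eq_of_expansion (l : ℕ) (m : ℤ) (R : SO3) (c : ℤ → ℂ)
    (hc : ∀ x : E3, x ≠ 0 → rotOp R (onVec (sphY l m)) x =
      ∑ m' ∈ Finset.Icc (-(l : ℤ)) l, c m' * onVec (sphY l m') x)
    (m' : ℤ) (hm' : m' ∈ Finset.Icc (-(l : ℤ)) l) : wignerD l m m' R = c m' := by
  have inner : ∀ θ ∈ Set.uIcc 0 Real.pi, ∫ φ in (0 : ℝ)..(2 * Real.pi),
      (starRingEnd ℂ) (sphY l m' θ φ) * rotOp R (onVec (sphY l m)) (unitVec θ φ) *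
        ((Real.sin θ : ℝ) : ℂ) =
      c m' * ((2 * Real.pi * polarPart l m' θ ^ 2 * Real.sin θ : ℝ) : ℂ) := by
    intro θ hθ
    rw [Set.uIcc_of_le Real.pi_pos.le] at hθ
    have hs := Real.sin_nonneg_of_mem_Icc hθ
    have h : ∀ φ : ℝ, (starRingEnd ℂ) (sphY l m' θ φ) *
        rotOp R (onVec (sphY l m)) (unitVec θ φ) * ((Real.sin θ : ℝ) : ℂ) =
        ∑ k ∈ Finset.Icc (-(l : ℤ)) l, (c k * ((Real.sin θ : ℝ) : ℂ)) *
          ((starRingEnd ℂ) (sphY l m' θ φ) * sphY l k θ φ) := by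
      intro φ
      rw [hc _ (unitVec_ne_zero θ φ), Finset.mul_sum, Finset.sum_mul]
      refine Finset.sum_congr rfl fun k hk => ?_
      rw [onVec_sphY_unitVec l k hk θ φ hs]
      ring
    simp only [h]
    rw [intervalIntegral.integral_finsetSum]
    · simp only [intervalIntegral.integral_const_mul, integral_conj_sphY_mul, mul_ite, mul_zero,
        Finset.sum_ite_eq', hm', if_true]
      push_cast
      ring
    · intro k _
      apply Continuous.intervalIntegrable
      simp only [sphY_eq_polarPart]
      fun_prop
  rw [wignerD, intervalIntegral.integral_congr inner, intervalIntegral.integral_const_mul,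
    intervalIntegral.integral_ofReal, integral_polarPart_sq l m' hm']
  simp

/-- `P(R) Y_{l,m} = ∑ D_{l,m,m'}(R) Y_{l,m'}`. -/
lemma rotOp_sphY (l : ℕ) (m : ℤ) (hm : m ∈ Finset.Icc (-(l : ℤ)) l) (R : SO3) (x : E3)
    (hx : x ≠ 0) : rotOp R (onVec (sphY l m)) x =
      ∑ m' ∈ Finset.Icc (-(l : ℤ)) l, wignerD l m m' R * onVec (sphY l m') x := by
  obtain ⟨c, hc⟩ := exists_rotOp_sphY l m hm R
  rw [hc x hx]
  refine Finset.sum_congr rfl fun m' hm' => ?_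
  rw [wignerD_eq_of_expansion l m R c hc m' hm']

/-! ### The real spherical harmonics -/

/-- The unitary change from the complex to the real basis, applied to a family indexed by the order
`m`. -/
def realComb (f : ℤ → ℂ) (m : ℤ) : ℂ :=
  if m < 0 then -(Complex.I / (Real.sqrt 2 : ℂ)) * (f m - (-1) ^ m * f (-m))
  else if m = 0 then f 0
  else (1 / (Real.sqrt 2 : ℂ)) * (f m + (-1) ^ m * f (-m))

/-- The complex conjugate of the change of basis `realComb`. -/
def realCombConj (f : ℤ → ℂ) (m : ℤ) : ℂ :=
  if m < 0 then (Complex.I / (Real.sqrt 2 : ℂ)) * (f m - (-1) ^ m * f (-m))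
  else if m = 0 then f 0
  else (1 / (Real.sqrt 2 : ℂ)) * (f m + (-1) ^ m * f (-m))

lemma sqrt_two_mul_self : (Real.sqrt 2 : ℂ) * (Real.sqrt 2 : ℂ) = 2 := by
  rw [← Complex.ofReal_mul, Real.mul_self_sqrt (by norm_num)]
  norm_num

lemma sqrt_two_ne_zero : (Real.sqrt 2 : ℂ) ≠ 0 := by
  exact_mod_cast (by positivity : Real.sqrt 2 ≠ 0)

lemma neg_one_zpow_mul_self (m : ℤ) : (-1 : ℂ) ^ m * (-1) ^ m = 1 := by
  rw [← mul_zpow]; simp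

lemma neg_one_zpow_add (m n : ℤ) : (-1 : ℂ) ^ (m + n) = (-1) ^ m * (-1) ^ n :=
  zpow_add₀ (by norm_num) m n

/-- Unitarity of the change of basis, on the span of the vectors of orders `m` and `-m`. -/
lemma realCombConj_mul_realComb (f g : ℤ → ℂ) (m : ℤ) :
    realCombConj f m * realComb g m + realCombConj f (-m) * realComb g (-m) =
      f m * g m + f (-m) * g (-m) := by
  have h1 := sqrt_two_mul_self
  have h3 := neg_one_zpow_mul_self m
  have hI := Complex.I_sq
  have hinv : ((Real.sqrt 2 : ℂ)⁻¹) ^ 2 = 1 / 2 := by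
    rw [inv_pow, pow_two, h1, one_div]
  rcases lt_trichotomy m 0 with h | h | h
  · have a1 : ¬ (-m < 0) := by omega
    have a2 : -m ≠ 0 := by omega
    simp only [realCombConj, realComb, h, a1, a2, if_true, if_false, neg_neg, neg_one_zpow_neg,
      div_eq_mul_inv, one_mul]
    generalize (-1 : ℂ) ^ m = e at *
    generalize (Real.sqrt 2 : ℂ)⁻¹ = t at *
    linear_combination (-t ^ 2 * (f m - e * f (-m)) * (g m - e * g (-m))) * hI +
      ((f m - e * f (-m)) * (g m - e * g (-m)) + (f (-m) + e * f m) * (g (-m) + e * g m)) * hinv +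
      (1 / 2) * (f m * g m + f (-m) * g (-m)) * h3
  · subst h
    simp [realCombConj, realComb]
  · have a0 : ¬ (m < 0) := by omega
    have a1 : -m < 0 := by omega
    have a2 : m ≠ 0 := by omega
    simp only [realCombConj, realComb, a0, a1, a2, if_true, if_false, neg_neg, neg_one_zpow_neg,
      div_eq_mul_inv, one_mul]
    generalize (-1 : ℂ) ^ m = e at *
    generalize (Real.sqrt 2 : ℂ)⁻¹ = t at *
    linear_combination (-t ^ 2 * (f (-m) - e * f m) * (g (-m) - e * g m)) * hI +
      ((f (-m) - e * f m) * (g (-m) - e * g m) + (f m + e * f (-m)) * (g m + e * g (-m))) * hinv +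
      (1 / 2) * (f m * g m + f (-m) * g (-m)) * h3

lemma sum_Icc_neg (l : ℕ) (f : ℤ → ℂ) :
    ∑ m ∈ Finset.Icc (-(l : ℤ)) l, f (-m) = ∑ m ∈ Finset.Icc (-(l : ℤ)) l, f m := by
  refine Finset.sum_nbij' (fun m => -m) (fun m => -m) ?_ ?_ ?_ ?_ ?_
  all_goals simp only [Finset.mem_Icc, neg_neg, implies_true]
  · intro a ha; omega
  · intro a ha; omega

/-- A bilinear pairing of two families is unchanged when one is expressed in the real basis and the
other in its conjugate. -/
lemma sum_realCombConj_mul_realComb (l : ℕ) (f g : ℤ → ℂ) :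
    ∑ m ∈ Finset.Icc (-(l : ℤ)) l, realCombConj f m * realComb g m =
      ∑ m ∈ Finset.Icc (-(l : ℤ)) l, f m * g m := by
  have h : ∑ m ∈ Finset.Icc (-(l : ℤ)) l,
      (realCombConj f m * realComb g m + realCombConj f (-m) * realComb g (-m)) =
      ∑ m ∈ Finset.Icc (-(l : ℤ)) l, (f m * g m + f (-m) * g (-m)) :=
    Finset.sum_congr rfl fun m _ => realCombConj_mul_realComb f g m
  rw [Finset.sum_add_distrib, Finset.sum_add_distrib,
    sum_Icc_neg l (fun m => realCombConj f m * realComb g m),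
    sum_Icc_neg l (fun m => f m * g m)] at h
  linear_combination (1 / 2 : ℂ) * h

lemma hatD_eq_realComb (l : ℕ) (m m' : ℤ) (R : SO3) :
    hatD l m m' R = realComb (fun n => wignerD l n m' R) m := rfl

lemma checkD_eq_realCombConj (l : ℕ) (m m' : ℤ) (R : SO3) :
    checkD l m m' R = realCombConj (fun n => hatD l m n R) m' := by
  have h1 := sqrt_two_mul_self
  have hI := Complex.I_sq
  have hinv : ((Real.sqrt 2 : ℂ)⁻¹) ^ 2 = 1 / 2 := by
    rw [inv_pow, pow_two, h1, one_div]
  simp only [checkD, realCombConj, hatD, neg_one_zpow_add]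
  split_ifs
  · simp only [div_eq_mul_inv, one_mul] at hinv ⊢
    generalize (Real.sqrt 2 : ℂ)⁻¹ = t at *
    generalize (-1 : ℂ) ^ m = e at *
    generalize (-1 : ℂ) ^ m' = e' at *
    linear_combination (t ^ 2 * (wignerD l m m' R - e * wignerD l (-m) m' R
        - e' * wignerD l m (-m') R + e * e' * wignerD l (-m) (-m') R)) * hI -
      (wignerD l m m' R - e * wignerD l (-m) m' R
        - e' * wignerD l m (-m') R + e * e' * wignerD l (-m) (-m') R) * hinv
  · rfl
  · simp only [div_eq_mul_inv, one_mul] at hinv ⊢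
    linear_combination Complex.I * (wignerD l m m' R - (-1) ^ m * wignerD l (-m) m' R
        + (-1) ^ m' * wignerD l m (-m') R -
        (-1) ^ m * (-1) ^ m' * wignerD l (-m) (-m') R) * hinv
  · rfl
  · rfl
  · rfl
  · simp only [div_eq_mul_inv, one_mul] at hinv ⊢
    linear_combination -Complex.I * (wignerD l m m' R + (-1) ^ m * wignerD l (-m) m' R
        - (-1) ^ m' * wignerD l m (-m') R -
        (-1) ^ m * (-1) ^ m' * wignerD l (-m) (-m') R) * hinv
  · rfl
  · simp only [div_eq_mul_inv, one_mul] at hinv ⊢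
    linear_combination -(wignerD l m m' R + (-1) ^ m * wignerD l (-m) m' R
        + (-1) ^ m' * wignerD l m (-m') R +
        (-1) ^ m * (-1) ^ m' * wignerD l (-m) (-m') R) * hinv

lemma realSphY_eq_realComb (l : ℕ) (m : ℤ) (hm : m ∈ Finset.Icc (-(l : ℤ)) l) (θ φ : ℝ)
    (hθ : 0 ≤ Real.sin θ) :
    ((realSphY l m θ φ : ℝ) : ℂ) = realComb (fun n => sphY l n θ φ) m := by
  have h1 := sqrt_two_mul_self
  have h2 := sqrt_two_ne_zero
  have hc := conj_sphY l m hm θ φ hθ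
  have hI := Complex.I_sq
  rw [realSphY, realComb]
  split_ifs with h h'
  · rw [← hc, Complex.ofReal_mul, Complex.im_eq_sub_conj]
    have := Complex.I_ne_zero
    field_simp
    linear_combination (sphY l m θ φ - (starRingEnd ℂ) (sphY l m θ φ)) * (h1 + 2 * hI)
  · subst h'
    rw [zpow_zero, one_mul, neg_zero] at hc
    exact Complex.conj_eq_iff_re.mp hc
  · rw [← hc, Complex.ofReal_mul, Complex.re_eq_add_conj]
    field_simp
    linear_combination (sphY l m θ φ + (starRingEnd ℂ) (sphY l m θ φ)) * h1

lemma onVec_realSphY (l : ℕ) (m : ℤ) (hm : m ∈ Finset.Icc (-(l : ℤ)) l) (x : E3) :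
    onVec (fun θ φ => ((realSphY l m θ φ : ℝ) : ℂ)) x =
      realComb (fun n => onVec (sphY l n) x) m :=
  realSphY_eq_realComb l m hm _ _ (sin_polarAngle_nonneg x)

lemma realComb_sum (s : Finset ℤ) (f : ℤ → ℤ → ℂ) (g : ℤ → ℂ) (m : ℤ) :
    realComb (fun n => ∑ k ∈ s, f n k * g k) m = ∑ k ∈ s, realComb (fun n => f n k) m * g k := by
  simp only [realComb]
  split_ifs
  · simp only [Finset.mul_sum, ← Finset.sum_sub_distrib]
    exact Finset.sum_congr rfl fun k _ => by ring
  · rfl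
  · simp only [Finset.mul_sum, ← Finset.sum_add_distrib]
    exact Finset.sum_congr rfl fun k _ => by ring

lemma realComb_congr {f g : ℤ → ℂ} {m : ℤ} (h : f m = g m) (h' : f (-m) = g (-m)) :
    realComb f m = realComb g m := by
  simp only [realComb]
  split_ifs with h1 h2
  · rw [h, h']
  · rwa [h2] at h
  · rw [h, h']

/-- `P(R) Y̌_{l,m} = ∑ D̂_{l,m,m'}(R) Y_{l,m'}`. -/
lemma rotOp_realSphY_eq_hatD (l : ℕ) (m : ℤ) (hm : m ∈ Finset.Icc (-(l : ℤ)) l) (R : SO3)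
    (x : E3) (hx : x ≠ 0) :
    rotOp R (onVec fun θ φ => ((realSphY l m θ φ : ℝ) : ℂ)) x =
      ∑ m' ∈ Finset.Icc (-(l : ℤ)) l,
        hatD l m m' R * sphY l m' (polarAngle x) (azimuth x) := by
  have hm' : -m ∈ Finset.Icc (-(l : ℤ)) l := by
    rw [Finset.mem_Icc] at hm ⊢; omega
  rw [rotOp, onVec_realSphY l m hm]
  simp only [hatD_eq_realComb]
  rw [← realComb_sum]
  exact realComb_congr (rotOp_sphY l m hm R x hx) (rotOp_sphY l (-m) hm' R x hx)

/-- `P(R) Y̌_{l,m} = ∑ Ď_{l,m,m'}(R) Y̌_{l,m'}`. -/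
lemma rotOp_realSphY_eq_checkD (l : ℕ) (m : ℤ) (hm : m ∈ Finset.Icc (-(l : ℤ)) l) (R : SO3)
    (x : E3) (hx : x ≠ 0) :
    rotOp R (onVec fun θ φ => ((realSphY l m θ φ : ℝ) : ℂ)) x =
      ∑ m' ∈ Finset.Icc (-(l : ℤ)) l,
        checkD l m m' R * ((realSphY l m' (polarAngle x) (azimuth x) : ℝ) : ℂ) := by
  rw [rotOp_realSphY_eq_hatD l m hm R x hx, ← sum_realCombConj_mul_realComb]
  refine Finset.sum_congr rfl fun m' hm' => ?_
  rw [checkD_eq_realCombConj, realSphY_eq_realComb l m' hm' _ _ (sin_polarAngle_nonneg x)]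

/-- The entries of the representation are real, so that the conjugation
in the projection operator has no effect. -/
lemma projOp_eq_sum {G : Type*} [Group G] [Fintype G] (ρ : G →* SO3) {d : ℕ}
    (Γr : G →* Matrix.orthogonalGroup (Fin d) ℝ) (j k : Fin d) (f : E3 → ℂ) (x : E3)
    (s : Finset ℤ) (D : ℤ → SO3 → ℂ) (y : ℤ → ℂ)
    (h : ∀ R : SO3, rotOp R f x = ∑ n ∈ s, D n R * y n) :
    projOp ρ (complexify Γr) j k f x =
      ∑ n ∈ s, ((d : ℂ) / (Fintype.card G : ℂ)) *
        (∑ g : G, (((Γr g : Matrix (Fin d) (Fin d) ℝ) j k : ℝ) : ℂ) * D n (ρ g)) * y n := by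
  simp only [projOp, h, complexify, Matrix.map_apply, Complex.conj_ofReal, Finset.mul_sum,
    Finset.sum_mul]
  rw [Finset.sum_comm]
  simp only [mul_assoc]

end

theorem lemma4p3 {G : Type*} [Group G] [Fintype G] (ρ : G →* SO3) {d : ℕ}
    (Γ : G →* Matrix.unitaryGroup (Fin d) ℂ) (hirr : (matrixRep Γ).IsIrreducible)
    (Γr : G →* Matrix.orthogonalGroup (Fin d) ℝ) (hreal : IsRealForm Γ Γr)
    (j k : Fin d) (l : ℕ) (m : ℤ) (hm : m ∈ Finset.Icc (-(l : ℤ)) l)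
    (x : E3) (hx : x ≠ 0) :
    projOp ρ (complexify Γr) j k (onVec fun θ φ => ((realSphY l m θ φ : ℝ) : ℂ)) x =
        ∑ m' ∈ Finset.Icc (-(l : ℤ)) l,
          checkCoeff ρ Γr j k l m m' * ((realSphY l m' (polarAngle x) (azimuth x) : ℝ) : ℂ) ∧
      projOp ρ (complexify Γr) j k (onVec fun θ φ => ((realSphY l m θ φ : ℝ) : ℂ)) x =
        ∑ m' ∈ Finset.Icc (-(l : ℤ)) l,
          hatCoeff ρ Γr j k l m m' * sphY l m' (polarAngle x) (azimuth x) := by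
  exact ⟨projOp_eq_sum ρ Γr j k _ x _ (fun m' R => checkD l m m' R) _
      fun R => rotOp_realSphY_eq_checkD l m hm R x hx,
    projOp_eq_sum ρ Γr j k _ x _ (fun m' R => hatD l m m' R) _
      fun R => rotOp_realSphY_eq_hatD l m hm R x hx⟩
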